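/- Let $E$ be a finite nonempty set of items, $O$ a set of states, and $p$ a discrete probability distribution on realizations $\phi: E\to O$; let $\Phi\sim p$. Let $f: 2^E\times O^E\to\mathbb{R}_{\ge 0}$ with $\mathbb{E}[f(A,\Phi)]<\infty$ for every $A\subseteq E$, and write $f(e)=\mathbb{E}[f(\{e\},\Phi)]$. A partial realization $\psi$ is a map from a subset $\mathrm{dom}(\psi)\subseteq E$ to $O$; write $\psi\prec\phi$ if $\phi$ extends $\psi$. For $\Pr[\psi\prec\Phi]>0$ put $$\Delta(e\mid\psi)=\mathbb{E}\left[f(\mathrm{dom}(\psi)\cup\{e\},\Phi)-f(\mathrm{dom}(\psi),\Phi)\mid\psi\prec\Phi\right].$$ Assume that $f$ is adaptive submodular with respect to $p$: $\Delta(e\mid\psi)\ge\Delta(e\mid\psi')$ whenever $\psi'$ extends $\psi$, $\Pr[\psi'\prec\Phi]>0$ and $e\notin\mathrm{dom}(\psi')$. (Pointwise submodularity is not assumed.) A (possibly randomized) policy $\pi$ selects items one at a time without repetition; each time an item is selected its state is revealed, and the choice of the next item, or the decision to stop, depends only on the observations so far and on internal randomness independent of $\Phi$. Let $E(\pi,\phi)$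 be the random set selected by $\pi$ under the realization $\phi$, and let $f_{avg}(\pi)=\mathbb{E}[f(E(\pi,\Phi),\Phi)]$. The concatenation $\pi@\pi'$ runs $\pi$ and then runs $\pi'$ afresh, ignoring the observations of $\pi$ and using independent randomness; it selects $E(\pi,\phi)\cup E(\pi',\phi)$. Given costs $c_e>0$ and a budget $b$, a policy is feasible if, for every $\phi$ with $p(\phi)>0$, almost surely $\sum_{e\in E(\pi,\phi)}c_e\le b$. Let $\pi^{opt}$ be a feasible policy that maximizes $f_{avg}$ among all feasible policies, and let $e^*\in\arg\max_{e\in E}f(e)$. Let $\sigma\in(0,1]$ and let $\pi$ be the following density-greedy policy. It draws a random set $S\subseteq E$ that contains each item independently with probability $\sigma$. While its current observation is $\psi$, it selects an item maximizing $\Delta(e\mid\psi)/c_e$ over $$F=\Big\{e\in S\setminus\mathrm{dom}(\psi) : c_e\le b-\sum_{i\in\mathrm{dom}(\psi)}c_i,\ \Delta(e\mid\psi)>0\Big\},$$ where ties are broken by an arbitrary priority order on $E$ that may depend on $\psi$ but not on $S$; it stops when $F=\emptyset$. Then $$\left(2+\frac1\sigma\right)f_{avg}(\pi)+f(e^*)\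 \ge\ f_{avg}(\pi^{opt}@\pi).$$ -/

import Mathlib

open scoped NNReal ENNReal

universe u v

namespace AdaptiveSubmodular

noncomputable section

/-- A partial realization: `ψ e = some o` means that `e` lies in the domain of `ψ` and has
state `o`; `ψ e = none` means that `e` is not in the domain. -/
abbrev PartialRealization (E : Type u) (O : Type v) := E → Option O

variable {E : Type u} {O : Type v} [Fintype E] [DecidableEq E]

/-- The domain of a partial realization. -/
def dom (ψ : PartialRealization E O) : Finset E :=
  Finset.univ.filter fun e => (ψ e).isSome

/-- `ψ` is consistent with the realization `φ`. -/
def Consistent (ψ : PartialRealization E O) (φ : E → O) : Prop :=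
  ∀ e o, ψ e = some o → φ e = o

/-- `ψ` is a subrealization of `ψ'`. -/
def SubRealization (ψ ψ' : PartialRealization E O) : Prop :=
  ∀ e o, ψ e = some o → ψ' e = some o

/-- The probability that the random realization is consistent with `ψ`. -/
def prob (p : PMF (E → O)) (ψ : PartialRealization E O) : ℝ :=
  ∑' φ, Set.indicator {φ | Consistent ψ φ} (fun φ => (p φ).toReal) φ

/-- The conditional expected marginal utility `Δ(e ∣ ψ)`. It is only meaningful
when `ψ` has positive probability. -/
def marginal (f : Finset E → (E → O) → ℝ≥0) (p : PMF (E → O)) (e : E)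
    (ψ : PartialRealization E O) : ℝ :=
  (∑' φ, Set.indicator {φ | Consistent ψ φ}
    (fun φ => (p φ).toReal * ((f (dom ψ ∪ {e}) φ : ℝ) - f (dom ψ) φ)) φ) / prob p ψ

/-- Every fixed set of items has a finite expected utility (automatic when the set of
realizations is finite). -/
def FiniteExpectation (f : Finset E → (E → O) → ℝ≥0) (p : PMF (E → O)) : Prop :=
  ∀ A : Finset E, Summable fun φ => (p φ).toReal * (f A φ : ℝ)

/-- Adaptive submodularity of `f` with respect to the prior `p`. -/
def IsAdaptiveSubmodular (f : Finset E → (E → O) → ℝ≥0) (p : PMF (E → O)) : Prop :=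
  ∀ ψ ψ' : PartialRealization E O, SubRealization ψ ψ' → 0 < prob p ψ' →
    ∀ e, e ∉ dom ψ' → marginal f p e ψ' ≤ marginal f p e ψ

/-- The expected utility `f(e)` of the single item `e`. -/
def singletonValue (f : Finset E → (E → O) → ℝ≥0) (p : PMF (E → O)) (e : E) : ℝ :=
  ∑' φ, (p φ).toReal * (f {e} φ : ℝ)

/-- An adaptive, possibly randomized, policy. It may draw a random seed before it starts; then
it maps the current observation to a distribution over the next item, where `none` means that it
stops. It never selects an item again that it has already selected. -/
structure Policy (E : Type u) (O : Type v) where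
  Seed : Type u
  law : PMF Seed
  next : Seed → PartialRealization E O → PMF (Option E)
  fresh : ∀ s ψ e, some e ∈ (next s ψ).support → ψ e = none

/-- The law of the observation obtained from `ψ` by making at most `n` further selections
according to the rule `g` under the realization `φ`. -/
def runFrom (g : PartialRealization E O → PMF (Option E)) (φ : E → O) :
    ℕ → PartialRealization E O → PMF (PartialRealization E O)
  | 0, ψ => PMF.pure ψ
  | n + 1, ψ => (g ψ).bind fun o =>
      match o with
      | none => PMF.pure ψ
      | some e => runFrom g φ n (Function.update ψ e (some (φ e)))

/-- The law of the random set `E(π, φ)` of the items selected by `π` under `φ`. A policy makes at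
most `|E|` selections because it never repeats an item. -/
def Policy.out (π : Policy E O) (φ : E → O) : PMF (Finset E) :=
  π.law.bind fun s => (runFrom (π.next s) φ (Fintype.card E) fun _ => none).map dom

/-- The law of the set selected by the concatenation `π @ π'` under `φ`: first `π` is run, then
`π'` is run afresh, ignoring the observations of `π` and with independent internal randomness. -/
def concatOut (π π' : Policy E O) (φ : E → O) : PMF (Finset E) :=
  (π.out φ).bind fun A => (π'.out φ).map fun B => A ∪ B

/-- The expected utility when the selected set has law `K φ` under the realization `φ`. -/
def expectedUtility (f : Finset E → (E → O) → ℝ≥0) (p : PMF (E → O))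
    (K : (E → O) → PMF (Finset E)) : ℝ :=
  ∑' φ, (p φ).toReal * ∑ A : Finset E, (K φ A).toReal * (f A φ : ℝ)

/-- `f_avg(π)`. -/
def favg (f : Finset E → (E → O) → ℝ≥0) (p : PMF (E → O)) (π : Policy E O) : ℝ :=
  expectedUtility f p π.out

/-- `f_avg(π @ π')`. -/
def favgConcat (f : Finset E → (E → O) → ℝ≥0) (p : PMF (E → O)) (π π' : Policy E O) : ℝ :=
  expectedUtility f p (concatOut π π')

/-- The policies that are feasible for the knapsack constraint with costs `c` and budget `b`. -/
def Feasible (p : PMF (E → O)) (c : E → ℝ) (b : ℝ) (π : Policy E O) : Prop :=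
  ∀ φ, p φ ≠ 0 → ∀ A ∈ (π.out φ).support, ∑ e ∈ A, c e ≤ b

/-- `π` is a feasible policy of maximum expected utility. -/
def IsOptimal (f : Finset E → (E → O) → ℝ≥0) (p : PMF (E → O)) (c : E → ℝ) (b : ℝ)
    (π : Policy E O) : Prop :=
  Feasible p c b π ∧ ∀ π' : Policy E O, Feasible p c b π' → favg f p π' ≤ favg f p π

/-- The law of a random set that contains each item independently with probability `σ`. -/
def sampleLaw (E : Type u) [Fintype E] [DecidableEq E] (σ : ℝ) (h0 : 0 < σ) (h1 : σ ≤ 1) :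
    PMF (Finset E) :=
  PMF.ofFintype
    (fun S => ENNReal.ofReal σ ^ S.card * ENNReal.ofReal (1 - σ) ^ (Fintype.card E - S.card)) <| by
    rw [Fintype.sum_pow_mul_eq_add_pow, ← ENNReal.ofReal_add h0.le (by linarith)]
    simp

/-- The candidates of the density-greedy rule: the items of `S` that have not been selected yet,
fit into the remaining budget and have a positive conditional expected marginal utility. -/
def candidates (f : Finset E → (E → O) → ℝ≥0) (p : PMF (E → O)) (c : E → ℝ) (b : ℝ)
    (S : Finset E) (ψ : PartialRealization E O) : Set E :=
  {e | e ∈ S ∧ e ∉ dom ψ ∧ c e ≤ b - ∑ i ∈ dom ψ, c i ∧ 0 < marginal f p e ψ}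

/-- `e` is the candidate of largest benefit-to-cost ratio, ties being broken in favour of the
smallest rank. -/
def IsGreedyChoice (f : Finset E → (E → O) → ℝ≥0) (p : PMF (E → O)) (c : E → ℝ) (b : ℝ)
    (rank : PartialRealization E O → E ↪ ℕ) (S : Finset E) (ψ : PartialRealization E O)
    (e : E) : Prop :=
  e ∈ candidates f p c b S ψ ∧ ∀ e' ∈ candidates f p c b S ψ,
    marginal f p e' ψ / c e' < marginal f p e ψ / c e ∨
      (marginal f p e' ψ / c e' = marginal f p e ψ / c e ∧ rank ψ e ≤ rank ψ e')

open Classical in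
/-- The next item of the density-greedy rule on `S`; `none` if there is no candidate. -/
def greedyNext (f : Finset E → (E → O) → ℝ≥0) (p : PMF (E → O)) (c : E → ℝ) (b : ℝ)
    (rank : PartialRealization E O → E ↪ ℕ) (S : Finset E) (ψ : PartialRealization E O) :
    Option E :=
  if h : ∃ e, IsGreedyChoice f p c b rank S ψ e then some h.choose else none

/-- The policy that draws a random set `S`, containing each item independently with probability
`σ`, and then selects items of `S` in the density-greedy manner. -/
def sampledGreedy (f : Finset E → (E → O) → ℝ≥0) (p : PMF (E → O)) (c : E → ℝ) (b : ℝ)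
    (rank : PartialRealization E O → E ↪ ℕ) (σ : ℝ) (h0 : 0 < σ) (h1 : σ ≤ 1) : Policy E O where
  Seed := Finset E
  law := sampleLaw E σ h0 h1
  next S ψ := PMF.pure (greedyNext f p c b rank S ψ)
  fresh S ψ e he := by
    have h : greedyNext f p c b rank S ψ = some e := by
      simpa [PMF.support_pure, eq_comm] using he
    unfold greedyNext at h
    split_ifs at h with hex
    have h2 := hex.choose_spec.1.2.1
    rw [Option.some.inj h] at h2
    simpa [dom] using h2

end

end AdaptiveSubmodular

/-!
Condition on the observation `ψ` with which the greedy run on the sample `S` ends. By adaptive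
submodularity, the utility of `dom ψ ∪ A` minus the leftover marginal utilities `Δ(e ∣ ψ)⁺` of the
items `e` of `A` is a supermartingale along the run of any other policy, `A` being the set that
this policy has selected so far. Hence a feasible policy adds to the greedy utility at most the
leftover marginals of a set of total cost at most `b`.

An item `e` has a positive leftover marginal for one of two reasons. Either `e` was not sampled and
the greedy run on `insert e S` would have collected at least this much from it; since
`Pr[S] = (1 / σ - 1) * Pr[insert e S]`, these items contribute on average at most `1 / σ - 1` times
the gains of the greedy run. Or `e` no longer fits into the budget, and then items of at least its
density have been bought for more than `b - c e`. The items of the second kind together contribute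
at most the gains of the run, apart from one item of largest cost, which contributes at most
`f(e*)`. The gains of the run add up to at most its expected utility.
-/
namespace AdaptiveSubmodular

noncomputable section

/-! ### Expectations under discrete laws -/

section Expectation

variable {α β ι : Type*} {q : PMF α} {C : Set α} {F G : α → ℝ}

theorem abs_le_sum_abs [Fintype α] (F : α → ℝ) (a : α) : |F a| ≤ ∑ b, |F b| :=
  Finset.single_le_sum (f := fun b => |F b|) (fun _ _ => abs_nonneg _) (Finset.mem_univ a)

/-- `F` has a finite expectation under `q`. -/
def HasExpectation (q : PMF α) (F : α → ℝ) : Prop :=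
  Summable fun a => (q a).toReal * F a

/-- The expectation `𝔼[F; C]` of `F` on the event `C`, not normalized by the probability of `C`;
the event defaults to the whole space. -/
def expect (q : PMF α) (F : α → ℝ) (C : Set α := Set.univ) : ℝ :=
  ∑' a, C.indicator (fun a => (q a).toReal * F a) a

theorem hasSum_toReal (q : PMF α) : HasSum (fun a => (q a).toReal) 1 := by
  have h := (ENNReal.summable_toReal q.tsum_coe_ne_top).hasSum
  rwa [← ENNReal.tsum_toReal_eq fun a => q.apply_ne_top a, q.tsum_coe, ENNReal.toReal_one] at h

namespace HasExpectation

theorem of_finite [Finite α] (q : PMF α) (F : α → ℝ) : HasExpectation q F :=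
  Summable.of_finite

theorem const (q : PMF α) (r : ℝ) : HasExpectation q fun _ => r :=
  (hasSum_toReal q).summable.mul_right r

theorem add (hF : HasExpectation q F) (hG : HasExpectation q G) :
    HasExpectation q fun a => F a + G a := by
  simpa only [HasExpectation, mul_add] using Summable.add hF hG

theorem sub (hF : HasExpectation q F) (hG : HasExpectation q G) :
    HasExpectation q fun a => F a - G a := by
  simpa only [HasExpectation, mul_sub] using Summable.sub hF hG

theorem sum {s : Finset ι} {F : ι → α → ℝ} (hF : ∀ i ∈ s, HasExpectation q (F i)) :
    HasExpectation q fun a => ∑ i ∈ s, F i a := by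
  simpa only [HasExpectation, Finset.mul_sum] using summable_sum hF

theorem of_abs_le (hG : HasExpectation q G) (h : ∀ a, |F a| ≤ G a) : HasExpectation q F := by
  refine Summable.of_norm_bounded hG fun a => ?_
  rw [Real.norm_eq_abs, abs_mul, abs_of_nonneg ENNReal.toReal_nonneg]
  exact mul_le_mul_of_nonneg_left (h a) ENNReal.toReal_nonneg

theorem abs (hF : HasExpectation q F) : HasExpectation q fun a => |F a| := by
  simpa only [HasExpectation, abs_mul, abs_of_nonneg ENNReal.toReal_nonneg] using
    Summable.abs hF

theorem apply [Finite β] {V : β → α → ℝ} (hV : ∀ b, HasExpectation q (V b)) (k : α → β) :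
    HasExpectation q fun a => V (k a) a := by
  have := Fintype.ofFinite β
  exact (HasExpectation.sum fun b (_ : b ∈ Finset.univ) => (hV b).abs).of_abs_le fun a =>
    abs_le_sum_abs (fun b => V b a) (k a)

end HasExpectation

theorem expect_congr (h : ∀ a ∈ C, q a ≠ 0 → F a = G a) : expect q F C = expect q G C := by
  refine tsum_congr fun a => ?_
  by_cases ha : a ∈ C
  · by_cases hq : q a = 0
    · simp [ha, hq]
    · simp [ha, h a ha hq]
  · simp [ha]

theorem expect_mono (hF : HasExpectation q F) (hG : HasExpectation q G)
    (h : ∀ a ∈ C, q a ≠ 0 → F a ≤ G a) : expect q F C ≤ expect q G C := by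
  refine Summable.tsum_le_tsum (fun a => ?_) (hF.indicator C) (hG.indicator C)
  refine Set.indicator_le_indicator' fun ha => ?_
  by_cases hq : q a = 0
  · simp [hq]
  · exact mul_le_mul_of_nonneg_left (h a ha hq) ENNReal.toReal_nonneg

theorem expect_nonneg (h : ∀ a ∈ C, 0 ≤ F a) : 0 ≤ expect q F C :=
  tsum_nonneg <| Set.indicator_nonneg fun a ha => mul_nonneg ENNReal.toReal_nonneg (h a ha)

theorem expect_add (hF : HasExpectation q F) (hG : HasExpectation q G) :
    expect q (fun a => F a + G a) C = expect q F C + expect q G C := by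
  simp only [expect, mul_add, Set.indicator_add]
  exact Summable.tsum_add (hF.indicator C) (hG.indicator C)

theorem expect_sub (hF : HasExpectation q F) (hG : HasExpectation q G) :
    expect q (fun a => F a - G a) C = expect q F C - expect q G C := by
  simp only [expect, mul_sub, Set.indicator_sub]
  exact Summable.tsum_sub (hF.indicator C) (hG.indicator C)

theorem expect_sum {s : Finset ι} {F : ι → α → ℝ} (hF : ∀ i ∈ s, HasExpectation q (F i)) :
    expect q (fun a => ∑ i ∈ s, F i a) C = ∑ i ∈ s, expect q (F i) C := by
  refine (tsum_congr fun a => ?_).trans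
    (Summable.tsum_finsetSum fun i hi => (hF i hi).indicator C)
  by_cases ha : a ∈ C <;> simp [ha, Finset.mul_sum]

theorem expect_mul_const (r : ℝ) : expect q (fun a => F a * r) C = expect q F C * r := by
  rw [expect, expect, ← tsum_mul_right]
  simp only [Set.indicator_mul_const, ← mul_assoc]

theorem expect_const (q : PMF α) (r : ℝ) : expect q (fun _ => r) = r := by
  rw [expect, Set.indicator_univ, tsum_mul_right, (hasSum_toReal q).tsum_eq, one_mul]

theorem expect_eq_sum [Fintype α] (q : PMF α) (F : α → ℝ) :
    expect q F = ∑ a, (q a).toReal * F a := by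
  rw [expect, Set.indicator_univ, tsum_fintype]

theorem abs_expect_le (hG : HasExpectation q G) (h : ∀ a, |F a| ≤ G a) :
    |expect q F C| ≤ expect q G C := by
  have hF := hG.of_abs_le h
  refine (norm_tsum_le_tsum_norm (hF.indicator C).norm).trans
    (Summable.tsum_le_tsum (fun a => ?_) (hF.indicator C).norm (hG.indicator C))
  rw [norm_indicator_eq_indicator_norm]
  refine Set.indicator_le_indicator ?_
  rw [Real.norm_eq_abs, abs_mul, abs_of_nonneg ENNReal.toReal_nonneg]
  exact mul_le_mul_of_nonneg_left (h a) ENNReal.toReal_nonneg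

theorem abs_expect_le_of_forall_abs_le {r : ℝ} (h : ∀ a, |F a| ≤ r) : |expect q F| ≤ r :=
  (abs_expect_le (.const q r) h).trans_eq (expect_const q r)

theorem abs_expect_le_sum [Fintype α] (q : PMF α) (F : α → ℝ) : |expect q F| ≤ ∑ a, |F a| :=
  abs_expect_le_of_forall_abs_le (abs_le_sum_abs F)

theorem HasExpectation.expect [Finite β] {V : β → α → ℝ} (hV : ∀ b, HasExpectation q (V b))
    (k : α → PMF β) : HasExpectation q fun a => expect (k a) fun b => V b a := by
  have := Fintype.ofFinite β
  exact (HasExpectation.sum fun b (_ : b ∈ Finset.univ) => (hV b).abs).of_abs_le fun a =>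
    abs_expect_le_sum (k a) _

theorem expect_pure (a : α) (F : α → ℝ) : expect (PMF.pure a) F = F a := by
  classical
  rw [expect, Set.indicator_univ, tsum_eq_single a fun b hb => by simp [PMF.pure_apply, hb]]
  simp

theorem expect_expect_comm {μ : PMF β} {X : β → α → ℝ} (hG : HasExpectation q G)
    (h : ∀ b a, |X b a| ≤ G a) :
    expect q (fun a => expect μ fun b => X b a) C = expect μ fun b => expect q (X b) C := by
  have hsum : Summable (Function.uncurry fun a b =>
      C.indicator (fun a => (q a).toReal * ((μ b).toReal * X b a)) a) := by
    refine Summable.of_norm_bounded (hG.abs.mul_of_nonneg (hasSum_toReal μ).summable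
      (fun a => by positivity) fun b => by positivity) fun x => ?_
    calc ‖C.indicator (fun a => (q a).toReal * ((μ x.2).toReal * X x.2 a)) x.1‖
        ≤ ‖(q x.1).toReal * ((μ x.2).toReal * X x.2 x.1)‖ := norm_indicator_le_norm_self _ _
      _ = (q x.1).toReal * |X x.2 x.1| * (μ x.2).toReal := by
        rw [norm_mul, norm_mul, Real.norm_of_nonneg ENNReal.toReal_nonneg,
          Real.norm_of_nonneg ENNReal.toReal_nonneg, Real.norm_eq_abs]
        ring
      _ ≤ (q x.1).toReal * |G x.1| * (μ x.2).toReal :=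
        mul_le_mul_of_nonneg_right (mul_le_mul_of_nonneg_left
          ((h _ _).trans (le_abs_self _)) ENNReal.toReal_nonneg) ENNReal.toReal_nonneg
  calc expect q (fun a => expect μ fun b => X b a) C
      = ∑' a, ∑' b, C.indicator (fun a => (q a).toReal * ((μ b).toReal * X b a)) a := by
        refine tsum_congr fun a => ?_
        by_cases ha : a ∈ C <;> simp [expect, ha, tsum_mul_left]
    _ = ∑' b, ∑' a, C.indicator (fun a => (q a).toReal * ((μ b).toReal * X b a)) a :=
        hsum.tsum_comm.symm
    _ = expect μ fun b => expect q (X b) C := by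
        simp only [expect, Set.indicator_univ, ← tsum_mul_left, ← Set.indicator_const_mul,
          mul_left_comm]

theorem expect_bind [Finite β] (μ : PMF α) (k : α → PMF β) (H : β → ℝ) :
    expect (μ.bind k) H = expect μ fun a => expect (k a) H := by
  have := Fintype.ofFinite β
  have hk : ∀ b, HasExpectation μ fun a => (k a b).toReal := fun b =>
    (HasExpectation.const μ 1).of_abs_le fun a => by
      rw [abs_of_nonneg ENNReal.toReal_nonneg]
      exact ENNReal.toReal_le_of_le_ofReal zero_le_one (by simpa using (k a).coe_le_one b)
  have hbind : ∀ b, (μ.bind k b).toReal = expect μ fun a => (k a b).toReal := fun b => by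
    rw [PMF.bind_apply, ENNReal.tsum_toReal_eq
      fun a => ENNReal.mul_ne_top (μ.apply_ne_top a) ((k a).apply_ne_top b)]
    simp only [expect, Set.indicator_univ, ENNReal.toReal_mul]
  simp only [expect_eq_sum, hbind, ← expect_mul_const]
  refine (expect_sum fun b _ => ?_).symm
  simpa only [HasExpectation, mul_assoc] using (hk b).mul_right (H b)

theorem expect_map [Finite β] (q : PMF α) (k : α → β) (H : β → ℝ) :
    expect (q.map k) H = expect q fun a => H (k a) := by
  simp only [← PMF.bind_pure_comp, expect_bind, Function.comp_apply, expect_pure]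

theorem hasSum_expect_fiber (X : α → ι) (hF : HasExpectation q F) :
    HasSum (fun i => expect q F (C ∩ X ⁻¹' {i})) (expect q F C) := by
  have hfiber : ∀ i, expect q F (C ∩ X ⁻¹' {i}) =
      ∑' a : X ⁻¹' {i}, C.indicator (fun a => (q a).toReal * F a) a := fun i => by
    rw [tsum_subtype (X ⁻¹' {i}) (C.indicator _), Set.indicator_indicator, Set.inter_comm, expect]
  rw [funext hfiber]
  exact (hF.indicator C).hasSum.tsum_fiberwise X

end Expectation

/-! ### Partial realizations -/

section PartialRealization

variable {E O : Type*} {ψ η : PartialRealization E O} {e : E} {o : O} {φ : E → O}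

/-- The event `ψ ≺ Φ`. -/
def extensions (ψ : PartialRealization E O) : Set (E → O) := {φ | Consistent ψ φ}

/-- The observation that combines `ψ` and `η`; where both are defined, `ψ` takes precedence. -/
def merge (ψ η : PartialRealization E O) : PartialRealization E O :=
  fun e => (ψ e).orElse fun _ => η e

theorem extensions_none : extensions (fun _ => none : PartialRealization E O) = Set.univ :=
  Set.eq_univ_of_forall fun _ _ _ h => nomatch h

theorem SubRealization.refl (ψ : PartialRealization E O) : SubRealization ψ ψ :=
  fun _ _ h => h

theorem SubRealization.trans {ψ₁ ψ₂ ψ₃ : PartialRealization E O} (h : SubRealization ψ₁ ψ₂)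
    (h' : SubRealization ψ₂ ψ₃) : SubRealization ψ₁ ψ₃ :=
  fun e o he => h' e o (h e o he)

theorem none_subRealization (ψ : PartialRealization E O) : SubRealization (fun _ => none) ψ :=
  fun _ _ h => nomatch h

theorem subRealization_merge (ψ η : PartialRealization E O) : SubRealization ψ (merge ψ η) :=
  fun e o h => by simp [merge, h]

theorem extensions_merge (hφ : φ ∈ extensions ψ ∩ extensions η) :
    extensions (merge ψ η) = extensions ψ ∩ extensions η := by
  refine Set.Subset.antisymm (fun φ' h => ⟨fun e o he => ?_, fun e o he => ?_⟩)
    fun φ' h e o he => ?_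
  · exact h e o (subRealization_merge ψ η e o he)
  · cases hψ : ψ e with
    | none => exact h e o (by simp [merge, hψ, he])
    | some o' => rw [h e o' (by simp [merge, hψ]), ← hφ.1 e o' hψ, hφ.2 e o he]
  · cases hψ : ψ e with
    | none => exact h.2 e o (by simpa [merge, hψ] using he)
    | some o' => exact h.1 e o (by simpa [merge, hψ] using he)

section Update

variable [DecidableEq E]

theorem subRealization_update (he : ψ e = none) (o : O) :
    SubRealization ψ (Function.update ψ e (some o)) := by
  intro a o' ha
  rwa [Function.update_of_ne]
  rintro rfl
  simp [he] at ha

theorem extensions_update (he : ψ e = none) (o : O) :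
    extensions (Function.update ψ e (some o)) = extensions ψ ∩ (fun φ => φ e) ⁻¹' {o} := by
  ext φ
  refine ⟨fun h => ⟨fun a o' ha => h a o' (subRealization_update he o a o' ha),
    h e o (by simp)⟩, ?_⟩
  rintro ⟨h, rfl⟩ a o' ha
  rcases eq_or_ne a e with rfl | hae
  · simpa using ha
  · exact h a o' (by rwa [Function.update_of_ne hae] at ha)

theorem hasSum_expect_update {p : PMF (E → O)} {C : Set (E → O)}
    {F : PartialRealization E O → (E → O) → ℝ} (he : η e = none)
    (hF : HasExpectation p fun φ => F (Function.update η e (some (φ e))) φ) :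
    HasSum (fun o => expect p (F (Function.update η e (some o)))
        (C ∩ extensions (Function.update η e (some o))))
      (expect p (fun φ => F (Function.update η e (some (φ e))) φ) (C ∩ extensions η)) := by
  convert hasSum_expect_fiber (fun φ => φ e) hF using 2 with o
  rw [extensions_update he, Set.inter_assoc]
  refine expect_congr fun φ hφ _ => ?_
  rw [← show φ e = o from hφ.2.2]

end Update

section Domain

variable [Fintype E]

theorem mem_dom : e ∈ dom ψ ↔ ∃ o, ψ e = some o := by
  simp [dom, Option.isSome_iff_exists]

theorem notMem_dom : e ∉ dom ψ ↔ ψ e = none := by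
  simp [dom]

theorem dom_none : dom (fun _ => none : PartialRealization E O) = ∅ := by
  simp [dom]

theorem SubRealization.dom_subset (h : SubRealization ψ η) : dom ψ ⊆ dom η := by
  intro e he
  obtain ⟨o, ho⟩ := mem_dom.mp he
  exact mem_dom.mpr ⟨o, h e o ho⟩

theorem dom_update [DecidableEq E] (ψ : PartialRealization E O) (e : E) (o : O) :
    dom (Function.update ψ e (some o)) = insert e (dom ψ) := by
  ext a
  by_cases h : a = e <;> simp [dom, Function.update_apply, h]

theorem dom_merge [DecidableEq E] (ψ η : PartialRealization E O) :
    dom (merge ψ η) = dom ψ ∪ dom η := by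
  ext e
  cases h : ψ e <;> simp [dom, merge, h]

end Domain

end PartialRealization

/-! ### Marginal utilities -/

section Marginal

variable {E O : Type*} {f : Finset E → (E → O) → ℝ≥0} {p : PMF (E → O)}
  {ψ η : PartialRealization E O} {e : E}

theorem prob_eq_expect (p : PMF (E → O)) (ψ : PartialRealization E O) :
    prob p ψ = expect p (fun _ => 1) (extensions ψ) := by
  simp [prob, expect, extensions]

theorem prob_nonneg (p : PMF (E → O)) (ψ : PartialRealization E O) : 0 ≤ prob p ψ :=
  (prob_eq_expect p ψ).symm ▸ expect_nonneg fun _ _ => zero_le_one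

theorem prob_pos {φ : E → O} (hφ : φ ∈ extensions ψ) (hp : p φ ≠ 0) : 0 < prob p ψ := by
  refine ((hasSum_toReal p).summable.indicator _).tsum_pos
    (fun _ => Set.indicator_nonneg (fun _ _ => ENNReal.toReal_nonneg) _) φ ?_
  rw [Set.indicator_of_mem (show φ ∈ {φ | Consistent ψ φ} from hφ)]
  exact ENNReal.toReal_pos hp (p.apply_ne_top φ)

theorem singletonValue_nonneg (f : Finset E → (E → O) → ℝ≥0) (p : PMF (E → O)) (e : E) :
    0 ≤ singletonValue f p e :=
  tsum_nonneg fun _ => mul_nonneg ENNReal.toReal_nonneg (NNReal.coe_nonneg _)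

variable [Fintype E] [DecidableEq E]

theorem expect_marginal (f : Finset E → (E → O) → ℝ≥0) (p : PMF (E → O)) (e : E)
    (ψ : PartialRealization E O) :
    expect p (fun _ => marginal f p e ψ) (extensions ψ) =
      expect p (fun φ => (f (insert e (dom ψ)) φ : ℝ) - f (dom ψ) φ) (extensions ψ) := by
  by_cases h : prob p ψ = 0
  · exact expect_congr fun φ hφ hp => absurd h (prob_pos hφ hp).ne'
  · have hprob := expect_mul_const (q := p) (C := extensions ψ) (F := fun _ => 1)
      (marginal f p e ψ)
    simp only [one_mul] at hprob
    rw [hprob, ← prob_eq_expect, marginal, mul_div_cancel₀ _ h, Finset.union_comm,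
      ← Finset.insert_eq]
    rfl

theorem marginal_none_le_singletonValue (hfin : FiniteExpectation f p) (e : E) :
    marginal f p e (fun _ => none) ≤ singletonValue f p e := by
  have h := expect_marginal f p e fun _ => none
  rw [extensions_none, expect_const, dom_none] at h
  rw [h, expect_sub (hfin _) (hfin _), insert_empty_eq]
  simpa [expect, singletonValue] using
    expect_nonneg (q := p) (C := Set.univ) fun φ _ => (f ∅ φ).coe_nonneg

theorem marginal_le_singletonValue (hfin : FiniteExpectation f p)
    (hf : IsAdaptiveSubmodular f p) (he : e ∉ dom ψ) :
    marginal f p e ψ ≤ singletonValue f p e := by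
  rcases (prob_nonneg p ψ).eq_or_lt with h | h
  · simpa [marginal, ← h] using singletonValue_nonneg f p e
  · exact (hf _ _ (none_subRealization ψ) h e he).trans
      (marginal_none_le_singletonValue hfin e)

theorem expect_marginal_le (hf : IsAdaptiveSubmodular f p) {d : ℝ} (hd : 0 ≤ d)
    (hψ : e ∉ dom ψ → marginal f p e ψ ≤ d) (hη : e ∉ dom η) :
    expect p (fun φ => (f (insert e (dom ψ ∪ dom η)) φ : ℝ) - f (dom ψ ∪ dom η) φ)
        (extensions ψ ∩ extensions η) ≤
      expect p (fun _ => d) (extensions ψ ∩ extensions η) := by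
  by_cases hex : ∃ φ ∈ extensions ψ ∩ extensions η, p φ ≠ 0
  · obtain ⟨φ, hφ, hp⟩ := hex
    by_cases heψ : e ∈ dom ψ
    · rw [Finset.insert_eq_of_mem (Finset.mem_union_left _ heψ)]
      simpa [expect] using expect_nonneg (q := p) fun _ _ => hd
    have hmerge := expect_marginal f p e (merge ψ η)
    rw [extensions_merge hφ, dom_merge] at hmerge
    rw [← hmerge]
    have hle : marginal f p e (merge ψ η) ≤ d :=
      (hf _ _ (subRealization_merge ψ η) (prob_pos (extensions_merge hφ ▸ hφ) hp) e
        (by simp [dom_merge, heψ, hη])).trans (hψ heψ)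
    exact expect_mono (.const _ _) (.const _ _) fun _ _ _ => hle
  · push Not at hex
    exact (expect_congr fun φ hφ hp => absurd (hex φ hφ) hp).le

end Marginal

/-! ### Running a policy on an event -/

section Run

variable {E O : Type*} [Fintype E] [DecidableEq E] {p : PMF (E → O)} {C : Set (E → O)}
  {V : Finset E → (E → O) → ℝ}

theorem expect_runFrom_succ (g : PartialRealization E O → PMF (Option E)) (φ : E → O) (n : ℕ)
    (η : PartialRealization E O) (H : Finset E → ℝ) :
    expect ((runFrom g φ (n + 1) η).map dom) H =
      expect (g η) fun x => x.elim (H (dom η)) fun e =>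
        expect ((runFrom g φ n (Function.update η e (some (φ e)))).map dom) H := by
  rw [runFrom, PMF.map_bind, expect_bind]
  refine expect_congr fun x _ _ => ?_
  cases x <;> simp [PMF.pure_map, expect_pure]

theorem expect_runFrom_le (hV : ∀ A, HasExpectation p (V A))
    {g : PartialRealization E O → PMF (Option E)}
    (hg : ∀ η e, some e ∈ (g η).support → η e = none)
    (hstep : ∀ η e, η e = none →
      expect p (V (insert e (dom η))) (C ∩ extensions η) ≤
        expect p (V (dom η)) (C ∩ extensions η)) (n : ℕ) (η : PartialRealization E O) :
    expect p (fun φ => expect ((runFrom g φ n η).map dom) fun A => V A φ) (C ∩ extensions η) ≤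
      expect p (V (dom η)) (C ∩ extensions η) := by
  have hK (K : (E → O) → PMF (Finset E)) : HasExpectation p fun φ =>
      expect (K φ) fun A => V A φ := .expect hV K
  have hbound : HasExpectation p fun φ => ∑ A, |V A φ| := .sum fun A _ => (hV A).abs
  induction n generalizing η with
  | zero => simp [runFrom, PMF.pure_map, expect_pure]
  | succ n ih =>
    have hselect (e : E) (he : η e = none) :
        expect p (fun φ => expect ((runFrom g φ n (Function.update η e (some (φ e)))).map dom)
          fun A => V A φ) (C ∩ extensions η) ≤ expect p (V (dom η)) (C ∩ extensions η) := by
      refine (hasSum_le (fun o => ?_) (hasSum_expect_update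
        (F := fun ζ φ => expect ((runFrom g φ n ζ).map dom) fun A => V A φ) he (hK _))
        (hasSum_expect_update (F := fun _ => V (insert e (dom η))) he (hV _))).trans
        (hstep η e he)
      simpa only [dom_update] using ih (Function.update η e (some o))
    simp only [expect_runFrom_succ]
    rw [expect_expect_comm hbound fun x φ => ?_, ← expect_const (g η) (expect p (V _) _)]
    · refine expect_mono (.of_finite _ _) (.of_finite _ _) fun x _ hx => ?_
      cases x with
      | none => exact le_rfl
      | some e => exact hselect e (hg η e hx)
    · cases x with
      | none => exact abs_le_sum_abs (fun A => V A φ) (dom η)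
      | some e => exact abs_expect_le_sum _ _

theorem expect_out_le (hV : ∀ A, HasExpectation p (V A)) (π : Policy E O)
    (hstep : ∀ η e, η e = none →
      expect p (V (insert e (dom η))) (C ∩ extensions η) ≤
        expect p (V (dom η)) (C ∩ extensions η)) :
    expect p (fun φ => expect (π.out φ) fun A => V A φ) C ≤ expect p (V ∅) C := by
  have hbound : HasExpectation p fun φ => ∑ A, |V A φ| := .sum fun A _ => (hV A).abs
  simp only [Policy.out, expect_bind]
  rw [expect_expect_comm hbound fun s φ => abs_expect_le_sum _ _,
    ← expect_const π.law (expect p (V ∅) C)]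
  refine expect_mono ?_ (.const _ _) fun s _ _ => ?_
  · exact (HasExpectation.const _ _).of_abs_le fun s =>
      abs_expect_le hbound fun φ => abs_expect_le_sum _ _
  · simpa only [extensions_none, Set.inter_univ, dom_none] using
      expect_runFrom_le hV (π.fresh s) hstep (Fintype.card E) fun _ => none

/-- Marginal utilities bound the gain of a policy because `f (dom ψ ∪ A) φ - ∑ e ∈ A, D e` is a
supermartingale along its run on the event `extensions ψ`. -/
theorem expect_out_union_le {f : Finset E → (E → O) → ℝ≥0} (hfin : FiniteExpectation f p)
    (hf : IsAdaptiveSubmodular f p) (π : Policy E O) (ψ : PartialRealization E O) {D : E → ℝ}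
    (hD : ∀ e, 0 ≤ D e) (hψ : ∀ e ∉ dom ψ, marginal f p e ψ ≤ D e) :
    expect p (fun φ => expect (π.out φ) fun A => (f (dom ψ ∪ A) φ : ℝ) - ∑ e ∈ A, D e)
        (extensions ψ) ≤ expect p (fun φ => (f (dom ψ) φ : ℝ)) (extensions ψ) := by
  have hV (A : Finset E) : HasExpectation p fun φ => (f (dom ψ ∪ A) φ : ℝ) - ∑ e ∈ A, D e :=
    .sub (hfin _) (.const _ _)
  refine (expect_out_le hV π fun η e he => ?_).trans (by simp)
  have hη := notMem_dom.mpr he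
  have h := expect_marginal_le (η := η) hf (hD e) (hψ e) hη
  rw [← sub_nonneg, ← expect_sub (.const _ _) (.sub (hfin _) (hfin _))] at h
  rw [← sub_nonneg, ← expect_sub (hV _) (hV _)]
  convert h using 3 with φ
  rw [Finset.sum_insert hη, Finset.union_insert]
  ring

end Run

/-! ### Deterministic rules -/

section DeterministicRule

variable {E O : Type*}

/-- The deterministic rule `g` for the choice of the next item never repeats an item. -/
def IsFresh (g : PartialRealization E O → Option E) : Prop :=
  ∀ η e, g η = some e → η e = none

section Observation

variable [DecidableEq E] {g : PartialRealization E O → Option E} {φ : E → O} {n : ℕ}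
  {η : PartialRealization E O} {e : E}

/-- The observation obtained from `η` by at most `n` further selections of the rule `g` under the
realization `φ`. -/
def detRun (g : PartialRealization E O → Option E) (φ : E → O) :
    ℕ → PartialRealization E O → PartialRealization E O
  | 0, η => η
  | n + 1, η => match g η with
    | none => η
    | some e => detRun g φ n (Function.update η e (some (φ e)))

theorem detRun_succ_none (h : g η = none) : detRun g φ (n + 1) η = η := by
  simp [detRun, h]

theorem detRun_succ_some (h : g η = some e) :
    detRun g φ (n + 1) η = detRun g φ n (Function.update η e (some (φ e))) := by
  simp [detRun, h]

theorem runFrom_pure (g : PartialRealization E O → Option E) (φ : E → O) (n : ℕ)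
    (η : PartialRealization E O) :
    runFrom (fun η => PMF.pure (g η)) φ n η = PMF.pure (detRun g φ n η) := by
  induction n generalizing η with
  | zero => rfl
  | succ n ih =>
    rw [runFrom, PMF.pure_bind, detRun]
    cases g η with
    | none => rfl
    | some e => exact ih _

theorem subRealization_detRun (hg : IsFresh g) : SubRealization η (detRun g φ n η) := by
  induction n generalizing η with
  | zero => exact SubRealization.refl η
  | succ n ih =>
    cases h : g η with
    | none => rw [detRun_succ_none h]; exact SubRealization.refl η
    | some e =>
      rw [detRun_succ_some h]
      exact (subRealization_update (hg η e h) _).trans ih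

theorem mem_extensions_detRun (hg : IsFresh g) (hη : φ ∈ extensions η) :
    φ ∈ extensions (detRun g φ n η) := by
  induction n generalizing η with
  | zero => exact hη
  | succ n ih =>
    cases h : g η with
    | none => rwa [detRun_succ_none h]
    | some e =>
      rw [detRun_succ_some h]
      exact ih (extensions_update (hg η e h) _ ▸ ⟨hη, rfl⟩)

theorem detRun_eq_of_mem_extensions (hg : IsFresh g) {φ' : E → O}
    (h' : φ' ∈ extensions (detRun g φ n η)) : detRun g φ' n η = detRun g φ n η := by
  induction n generalizing η with
  | zero => rfl
  | succ n ih =>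
    cases h : g η with
    | none => rw [detRun_succ_none h, detRun_succ_none h]
    | some e =>
      rw [detRun_succ_some h] at h' ⊢
      have he : φ' e = φ e := h' e (φ e) (subRealization_detRun hg e (φ e) (by simp))
      rw [detRun_succ_some h, he, ih h']

theorem mem_dom_detRun [Fintype E] (hg : IsFresh g) (h : g η = some e) :
    e ∈ dom (detRun g φ (n + 1) η) := by
  rw [detRun_succ_some h]
  refine (subRealization_detRun hg).dom_subset ?_
  rw [dom_update]
  exact Finset.mem_insert_self e _

end Observation

variable [Fintype E] [DecidableEq E] {f : Finset E → (E → O) → ℝ≥0} {p : PMF (E → O)}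
  {g : PartialRealization E O → Option E} {φ : E → O} {n : ℕ} {η : PartialRealization E O}
  {e : E}

/-- The marginal utility of `e` at the time of its selection in a run of the rule `g` from `η`;
it is zero if `e` is not selected. -/
def itemGain (f : Finset E → (E → O) → ℝ≥0) (p : PMF (E → O))
    (g : PartialRealization E O → Option E) (φ : E → O) (e : E) :
    ℕ → PartialRealization E O → ℝ
  | 0, _ => 0
  | n + 1, η => match g η with
    | none => 0
    | some e' => (if e' = e then marginal f p e η else 0) +
        itemGain f p g φ e n (Function.update η e' (some (φ e')))

/-- The sum of the marginal utilities collected in a run of the rule `g` from `η`. -/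
def totalGain (f : Finset E → (E → O) → ℝ≥0) (p : PMF (E → O))
    (g : PartialRealization E O → Option E) (φ : E → O) (n : ℕ)
    (η : PartialRealization E O) : ℝ :=
  ∑ e, itemGain f p g φ e n η

theorem itemGain_succ_none (h : g η = none) : itemGain f p g φ e (n + 1) η = 0 := by
  simp [itemGain, h]

theorem itemGain_succ_some {e' : E} (h : g η = some e') :
    itemGain f p g φ e (n + 1) η = (if e' = e then marginal f p e η else 0) +
      itemGain f p g φ e n (Function.update η e' (some (φ e'))) := by
  simp [itemGain, h]

theorem totalGain_succ_none (h : g η = none) : totalGain f p g φ (n + 1) η = 0 := by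
  simp [totalGain, itemGain_succ_none h]

theorem totalGain_succ_some (h : g η = some e) :
    totalGain f p g φ (n + 1) η = marginal f p e η +
      totalGain f p g φ n (Function.update η e (some (φ e))) := by
  simp [totalGain, itemGain_succ_some h, Finset.sum_add_distrib]

theorem itemGain_eq_zero (hg : ∀ η, g η ≠ some e) : itemGain f p g φ e n η = 0 := by
  induction n generalizing η with
  | zero => rfl
  | succ n ih =>
    cases h : g η with
    | none => rw [itemGain_succ_none h]
    | some e' => rw [itemGain_succ_some h, if_neg fun he : e' = e => hg η (he ▸ h), ih, add_zero]

theorem itemGain_nonneg (hpos : ∀ η, g η = some e → 0 ≤ marginal f p e η) :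
    0 ≤ itemGain f p g φ e n η := by
  induction n generalizing η with
  | zero => exact le_rfl
  | succ n ih =>
    cases h : g η with
    | none => rw [itemGain_succ_none h]
    | some e' =>
      rw [itemGain_succ_some h]
      refine add_nonneg ?_ ih
      split_ifs with he
      · exact hpos η (he ▸ h)
      · exact le_rfl

theorem totalGain_nonneg (hpos : ∀ η e, g η = some e → 0 ≤ marginal f p e η) :
    0 ≤ totalGain f p g φ n η :=
  Finset.sum_nonneg fun e _ => itemGain_nonneg fun η => hpos η e

theorem itemGain_le {K : ℝ} (hK : 0 ≤ K) (hb : ∀ η, g η = some e → marginal f p e η ≤ K) :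
    itemGain f p g φ e n η ≤ n * K := by
  induction n generalizing η with
  | zero => simp [itemGain]
  | succ n ih =>
    cases h : g η with
    | none =>
      rw [itemGain_succ_none h]
      positivity
    | some e' =>
      rw [itemGain_succ_some h, Nat.cast_succ, add_one_mul, add_comm]
      refine add_le_add ih ?_
      split_ifs with he
      · exact hb η (he ▸ h)
      · exact hK

theorem marginal_le_itemGain (hpos : ∀ η, g η = some e → 0 ≤ marginal f p e η)
    (h : g η = some e) : marginal f p e η ≤ itemGain f p g φ e (n + 1) η := by
  rw [itemGain_succ_some h, if_pos rfl]
  exact le_add_of_nonneg_right (itemGain_nonneg hpos)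

theorem hasExpectation_itemGain (hfin : FiniteExpectation f p) (hf : IsAdaptiveSubmodular f p)
    (hg : IsFresh g) (hpos : ∀ η, g η = some e → 0 ≤ marginal f p e η) (n : ℕ)
    (η : (E → O) → PartialRealization E O) :
    HasExpectation p fun φ => itemGain f p g φ e n (η φ) := by
  refine (HasExpectation.const p (n * singletonValue f p e)).of_abs_le fun φ => ?_
  rw [abs_of_nonneg (itemGain_nonneg hpos)]
  exact itemGain_le (singletonValue_nonneg f p e) fun η h =>
    marginal_le_singletonValue hfin hf (notMem_dom.mpr (hg η e h))

theorem hasExpectation_totalGain (hfin : FiniteExpectation f p) (hf : IsAdaptiveSubmodular f p)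
    (hg : IsFresh g) (hpos : ∀ η e, g η = some e → 0 ≤ marginal f p e η) (n : ℕ)
    (η : (E → O) → PartialRealization E O) :
    HasExpectation p fun φ => totalGain f p g φ n (η φ) :=
  .sum fun e _ => hasExpectation_itemGain hfin hf hg (fun η => hpos η e) n η

theorem expect_totalGain (hfin : FiniteExpectation f p) (hf : IsAdaptiveSubmodular f p)
    (hg : IsFresh g) (hpos : ∀ η e, g η = some e → 0 ≤ marginal f p e η) (n : ℕ)
    (η : PartialRealization E O) :
    expect p (fun φ => totalGain f p g φ n η) (extensions η) =
      expect p (fun φ => (f (dom (detRun g φ n η)) φ : ℝ) - f (dom η) φ) (extensions η) := by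
  induction n generalizing η with
  | zero => simp [totalGain, itemGain, detRun]
  | succ n ih =>
    cases h : g η with
    | none => simp [totalGain_succ_none h, detRun_succ_none h]
    | some e =>
      have hutility (A : (E → O) → Finset E) (B : Finset E) :
          HasExpectation p fun φ => (f (A φ) φ : ℝ) - f B φ :=
        .sub (.apply (V := fun A φ => (f A φ : ℝ)) hfin A) (hfin B)
      have hrest := (hasSum_expect_update (p := p) (C := Set.univ)
        (F := fun ζ φ => totalGain f p g φ n ζ) (hg η e h)
        (hasExpectation_totalGain hfin hf hg hpos n _)).unique <| by
          simpa only [Set.univ_inter, ih, dom_update] using hasSum_expect_update (p := p)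
            (C := Set.univ) (F := fun ζ φ => (f (dom (detRun g φ n ζ)) φ : ℝ) -
              f (insert e (dom η)) φ) (hg η e h) (hutility _ _)
      simp only [totalGain_succ_some h, detRun_succ_some h]
      rw [Set.univ_inter] at hrest
      rw [expect_add (.const _ _) (hasExpectation_totalGain hfin hf hg hpos n _), hrest,
        expect_marginal, ← expect_add (hutility _ _) (hutility _ _)]
      exact expect_congr fun φ _ _ => by ring

/-- The observation of the rule `g` under `φ` when it stops. The horizon `|E|` is no restriction
for a rule that never repeats an item. -/
def finalObservation (g : PartialRealization E O → Option E) (φ : E → O) :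
    PartialRealization E O :=
  detRun g φ (Fintype.card E) fun _ => none

/-- The gain of `e` in the run of the rule `g` that starts without observations. -/
def gain (f : Finset E → (E → O) → ℝ≥0) (p : PMF (E → O))
    (g : PartialRealization E O → Option E) (φ : E → O) (e : E) : ℝ :=
  itemGain f p g φ e (Fintype.card E) fun _ => none

/-- The marginal utility that is left to `e` after the observation `ψ`: the positive part of its
marginal utility, and zero if `e` has been observed. -/
def residual (f : Finset E → (E → O) → ℝ≥0) (p : PMF (E → O)) (ψ : PartialRealization E O)
    (e : E) : ℝ :=
  if e ∈ dom ψ then 0 else max 0 (marginal f p e ψ)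

theorem expect_sum_gain_le (hfin : FiniteExpectation f p) (hf : IsAdaptiveSubmodular f p)
    (hg : IsFresh g) (hpos : ∀ η e, g η = some e → 0 ≤ marginal f p e η) :
    expect p (fun φ => ∑ e, gain f p g φ e) ≤
      expect p fun φ => (f (dom (finalObservation g φ)) φ : ℝ) := by
  have hfinal : HasExpectation p fun φ => (f (dom (finalObservation g φ)) φ : ℝ) :=
    .apply (V := fun A φ => (f A φ : ℝ)) hfin _
  have h := expect_totalGain hfin hf hg hpos (Fintype.card E) fun _ => none
  rw [extensions_none] at h
  refine h.trans_le (expect_mono (hfinal.sub (hfin _)) hfinal fun φ _ _ => ?_)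
  exact sub_le_self _ (NNReal.coe_nonneg _)

theorem residual_nonneg (ψ : PartialRealization E O) (e : E) : 0 ≤ residual f p ψ e := by
  unfold residual
  split_ifs
  exacts [le_rfl, le_max_left _ _]

theorem residual_le_singletonValue (hfin : FiniteExpectation f p)
    (hf : IsAdaptiveSubmodular f p) (ψ : PartialRealization E O) (e : E) :
    residual f p ψ e ≤ singletonValue f p e := by
  unfold residual
  split_ifs with he
  · exact singletonValue_nonneg f p e
  · exact max_le (singletonValue_nonneg f p e) (marginal_le_singletonValue hfin hf he)

theorem hasExpectation_sum_residual (hfin : FiniteExpectation f p)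
    (hf : IsAdaptiveSubmodular f p) (ψ : (E → O) → PartialRealization E O) (A : Finset E) :
    HasExpectation p fun φ => ∑ e ∈ A, residual f p (ψ φ) e :=
  .sum fun e _ => (HasExpectation.const p (singletonValue f p e)).of_abs_le fun φ =>
    (abs_of_nonneg (residual_nonneg (ψ φ) e)).trans_le (residual_le_singletonValue hfin hf (ψ φ) e)

theorem preimage_finalObservation (hg : IsFresh g) (φ : E → O) :
    finalObservation g ⁻¹' {finalObservation g φ} = extensions (finalObservation g φ) :=
  Set.Subset.antisymm
    (fun φ' h => (show finalObservation g φ' = finalObservation g φ from h) ▸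
      mem_extensions_detRun hg (extensions_none ▸ Set.mem_univ φ'))
    fun _ h => detRun_eq_of_mem_extensions hg h

theorem expect_out_union_finalObservation_le (hfin : FiniteExpectation f p)
    (hf : IsAdaptiveSubmodular f p) (hg : IsFresh g) (π : Policy E O) :
    expect p (fun φ => expect (π.out φ) fun A => (f (A ∪ dom (finalObservation g φ)) φ : ℝ)) ≤
      expect p (fun φ => (f (dom (finalObservation g φ)) φ : ℝ)) +
        expect p fun φ => expect (π.out φ) fun A =>
          ∑ e ∈ A, residual f p (finalObservation g φ) e := by
  have hutility (A : (E → O) → Finset E) : HasExpectation p fun φ => (f (A φ) φ : ℝ) :=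
    .apply (V := fun A φ => (f A φ : ℝ)) hfin A
  have hunion : HasExpectation p fun φ => expect (π.out φ) fun A =>
    (f (A ∪ dom (finalObservation g φ)) φ : ℝ) := .expect (fun _ => hutility _) _
  have hresidual : HasExpectation p fun φ => expect (π.out φ) fun A =>
    ∑ e ∈ A, residual f p (finalObservation g φ) e :=
      .expect (hasExpectation_sum_residual hfin hf _) _
  rw [← sub_le_iff_le_add, ← expect_sub hunion hresidual]
  refine hasSum_le (fun ψ => ?_) (hasSum_expect_fiber (finalObservation g) (hunion.sub hresidual))
    (hasSum_expect_fiber (finalObservation g) (hutility _))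
  rw [Set.univ_inter]
  rcases (finalObservation g ⁻¹' {ψ}).eq_empty_or_nonempty with hempty | ⟨φ, rfl⟩
  · simp [hempty, expect]
  have hfinal (φ') (h : φ' ∈ extensions (finalObservation g φ)) :
      finalObservation g φ' = finalObservation g φ := detRun_eq_of_mem_extensions hg h
  rw [preimage_finalObservation hg]
  calc _ = expect p (fun φ' => expect (π.out φ') fun A =>
          (f (dom (finalObservation g φ) ∪ A) φ' : ℝ) -
            ∑ e ∈ A, residual f p (finalObservation g φ) e) (extensions _) :=
        expect_congr fun φ' h _ => by
          simp only [hfinal φ' h, Finset.union_comm,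
            expect_sub (HasExpectation.of_finite _ _) (HasExpectation.of_finite _ _)]
    _ ≤ _ := expect_out_union_le hfin hf π _ (residual_nonneg _) fun e he => by
          rw [residual, if_neg he]
          exact le_max_right _ _
    _ = _ := expect_congr fun φ' h _ => by rw [hfinal φ' h]

end DeterministicRule

/-! ### The density-greedy rule -/

section Greedy

variable {E O : Type*} [Fintype E] [DecidableEq E] {f : Finset E → (E → O) → ℝ≥0}
  {p : PMF (E → O)} {c : E → ℝ} {b : ℝ} {rank : PartialRealization E O → E ↪ ℕ} {S : Finset E}
  {η : PartialRealization E O} {e e' : E} {φ : E → O}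

theorem IsGreedyChoice.eq (h : IsGreedyChoice f p c b rank S η e)
    (h' : IsGreedyChoice f p c b rank S η e') : e = e' := by
  rcases h.2 e' h'.1 with hlt | ⟨heq, hrank⟩
  · rcases h'.2 e h.1 with hlt' | ⟨heq', -⟩
    exacts [absurd hlt hlt'.asymm, absurd heq' hlt.ne']
  · rcases h'.2 e h.1 with hlt' | ⟨-, hrank'⟩
    exacts [absurd heq hlt'.ne', (rank η).injective (hrank.antisymm hrank')]

theorem IsGreedyChoice.marginal_mul_le (hc : ∀ e, 0 < c e)
    (h : IsGreedyChoice f p c b rank S η e') (he : e ∈ candidates f p c b S η) :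
    marginal f p e η * c e' ≤ marginal f p e' η * c e := by
  rw [← div_le_div_iff₀ (hc e) (hc e')]
  exact (h.2 e he).elim le_of_lt fun h => h.1.le

theorem exists_isGreedyChoice (rank : PartialRealization E O → E ↪ ℕ)
    (h : (candidates f p c b S η).Nonempty) :
    ∃ e, IsGreedyChoice f p c b rank S η e := by
  let key (e : E) : ℝ ×ₗ ℕᵒᵈ := toLex (marginal f p e η / c e, OrderDual.toDual (rank η e))
  obtain ⟨e, he, hmax⟩ := Set.exists_max_image _ key (Set.toFinite _) h
  exact ⟨e, he, fun e' he' => Prod.Lex.le_iff.mp (hmax e' he')⟩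

theorem greedyNext_eq_some :
    greedyNext f p c b rank S η = some e ↔ IsGreedyChoice f p c b rank S η e := by
  unfold greedyNext
  split_ifs with hex
  · rw [Option.some.injEq]
    exact ⟨fun h => h ▸ hex.choose_spec, hex.choose_spec.eq⟩
  · simpa using fun h => hex ⟨e, h⟩

theorem isFresh_greedyNext : IsFresh (greedyNext f p c b rank S) :=
  fun _ _ h => notMem_dom.mp (greedyNext_eq_some.mp h).1.2.1

theorem mem_of_greedyNext (h : greedyNext f p c b rank S η = some e) : e ∈ S :=
  (greedyNext_eq_some.mp h).1.1

theorem marginal_pos_of_greedyNext (h : greedyNext f p c b rank S η = some e) :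
    0 < marginal f p e η :=
  (greedyNext_eq_some.mp h).1.2.2.2

theorem greedyNext_of_insert (hne : e' ≠ e)
    (h : greedyNext f p c b rank (insert e S) η = some e') :
    greedyNext f p c b rank S η = some e' := by
  obtain ⟨⟨hmem, hrest⟩, hmax⟩ := greedyNext_eq_some.mp h
  exact greedyNext_eq_some.mpr ⟨⟨Finset.mem_of_mem_insert_of_ne hmem hne, hrest⟩,
    fun a ha => hmax a ⟨Finset.mem_insert_of_mem ha.1, ha.2⟩⟩

theorem gain_greedyNext_nonneg : 0 ≤ gain f p (greedyNext f p c b rank S) φ e :=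
  itemGain_nonneg fun _ h => (marginal_pos_of_greedyNext h).le

theorem gain_greedyNext_eq_zero (he : e ∉ S) : gain f p (greedyNext f p c b rank S) φ e = 0 :=
  itemGain_eq_zero fun _ h => he (mem_of_greedyNext h)

theorem sum_gain_greedyNext : ∑ e ∈ S, gain f p (greedyNext f p c b rank S) φ e =
    ∑ e, gain f p (greedyNext f p c b rank S) φ e :=
  Finset.sum_subset (Finset.subset_univ S) fun _ _ => gain_greedyNext_eq_zero

theorem hasExpectation_gain_greedyNext (hfin : FiniteExpectation f p)
    (hf : IsAdaptiveSubmodular f p) (S : Finset E) (e : E) :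
    HasExpectation p fun φ => gain f p (greedyNext f p c b rank S) φ e :=
  hasExpectation_itemGain hfin hf isFresh_greedyNext
    (fun _ h => (marginal_pos_of_greedyNext h).le) _ _

/-- Compare the runs on `S` and on `insert e S`: they agree until the latter selects `e`, and as
long as `e` fits into the budget, they select items of at least the density of `e`. -/
theorem le_itemGain_or_mul_le_totalGain (hc : ∀ e, 0 < c e) {d : ℝ} (hd : 0 < d) (n : ℕ)
    (hcard : Fintype.card E ≤ n + (dom η).card)
    (he : e ∉ dom (detRun (greedyNext f p c b rank S) φ n η))
    (hmarginal : ∀ ζ, SubRealization ζ (detRun (greedyNext f p c b rank S) φ n η) →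
      d ≤ marginal f p e ζ) :
    (e ∉ S ∧ d ≤ itemGain f p (greedyNext f p c b rank (insert e S)) φ e n η) ∨
      d * (b - c e - ∑ i ∈ dom η, c i) ≤
        c e * totalGain f p (greedyNext f p c b rank S) φ n η := by
  induction n generalizing η with
  | zero =>
    exact absurd (Finset.eq_univ_of_card (dom η) (by linarith [Finset.card_le_univ (dom η)]) ▸
      Finset.mem_univ e) he
  | succ n ih =>
    have hsub := subRealization_detRun (φ := φ) (n := n + 1) (η := η)
      (isFresh_greedyNext (f := f) (p := p) (c := c) (b := b) (rank := rank) (S := S))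
    by_cases hfit : c e ≤ b - ∑ i ∈ dom η, c i
    · have hcandidate : e ∈ candidates f p c b (insert e S) η :=
        ⟨Finset.mem_insert_self e S, fun h => he (hsub.dom_subset h), hfit,
          hd.trans_le (hmarginal η hsub)⟩
      obtain ⟨e', hchoice⟩ := exists_isGreedyChoice rank ⟨e, hcandidate⟩
      have hnext := greedyNext_eq_some.mpr hchoice
      rcases eq_or_ne e' e with rfl | hne
      · refine Or.inl ⟨fun heS => ?_, (hmarginal η hsub).trans (marginal_le_itemGain
          (fun _ h => (marginal_pos_of_greedyNext h).le) hnext)⟩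
        rw [Finset.insert_eq_of_mem heS] at hnext
        exact he (mem_dom_detRun isFresh_greedyNext hnext)
      · have hnext' := greedyNext_of_insert hne hnext
        have hdensity : d * c e' ≤ marginal f p e' η * c e :=
          (mul_le_mul_of_nonneg_right (hmarginal η hsub) (hc e').le).trans
            (hchoice.marginal_mul_le hc hcandidate)
        have he' : e' ∉ dom η := hchoice.1.2.1
        rw [detRun_succ_some hnext'] at he hmarginal
        rw [itemGain_succ_some hnext, if_neg hne, zero_add, totalGain_succ_some hnext']
        refine (ih ?_ he hmarginal).imp_right fun h => ?_
        · rw [dom_update, Finset.card_insert_of_notMem he']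
          omega
        · rw [dom_update, Finset.sum_insert he'] at h
          linarith
    · exact Or.inr ((mul_nonpos_of_nonneg_of_nonpos hd.le (by linarith)).trans
        (mul_nonneg (hc e).le (totalGain_nonneg fun _ _ h => (marginal_pos_of_greedyNext h).le)))

theorem le_gain_or_mul_le_sum_gain (hf : IsAdaptiveSubmodular f p) (hc : ∀ e, 0 < c e)
    (hφ : p φ ≠ 0) (S : Finset E) (e : E) :
    (e ∉ S ∧ residual f p (finalObservation (greedyNext f p c b rank S) φ) e ≤
        gain f p (greedyNext f p c b rank (insert e S)) φ e) ∨
      residual f p (finalObservation (greedyNext f p c b rank S) φ) e * (b - c e) ≤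
        c e * ∑ e ∈ S, gain f p (greedyNext f p c b rank S) φ e := by
  set ψ := finalObservation (greedyNext f p c b rank S) φ
  rcases (residual_nonneg (f := f) (p := p) ψ e).eq_or_lt with hzero | hpos
  · rw [← hzero, zero_mul]
    exact Or.inr (mul_nonneg (hc e).le (Finset.sum_nonneg fun _ _ => gain_greedyNext_nonneg))
  have he : e ∉ dom ψ := fun h => hpos.ne' (if_pos h)
  have hresidual : residual f p ψ e = marginal f p e ψ := by
    rw [residual, if_neg he] at hpos ⊢
    exact max_eq_right (lt_max_iff.mp hpos |>.resolve_left (lt_irrefl 0)).le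
  have hprob : 0 < prob p ψ :=
    prob_pos (mem_extensions_detRun isFresh_greedyNext (extensions_none ▸ Set.mem_univ φ)) hφ
  have h := le_itemGain_or_mul_le_totalGain (rank := rank) (b := b) (S := S) (φ := φ) hc hpos
    (Fintype.card E) (η := fun _ => none) (Nat.le_add_right _ _) he
    fun ζ hζ => hresidual.trans_le (hf ζ ψ hζ hprob e he)
  rw [dom_none, Finset.sum_empty, sub_zero] at h
  rwa [sum_gain_greedyNext]

/-- Apart from one item `m` of largest cost, the items `i` cost at most `b - c m ≤ b - c i` in
total, so `G` covers their values if each of them is charged in proportion to its cost. -/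
theorem sum_le_add_of_density_le {ι : Type*} {T : Finset ι} {c d : ι → ℝ} {b G M : ℝ}
    (hc : ∀ i ∈ T, 0 < c i) (hG : 0 ≤ G) (hM : 0 ≤ M) (hT : ∑ i ∈ T, c i ≤ b)
    (hd : ∀ i ∈ T, 0 ≤ d i) (hdG : ∀ i ∈ T, d i * (b - c i) ≤ c i * G)
    (hdM : ∀ i ∈ T, d i ≤ M) : ∑ i ∈ T, d i ≤ G + M := by
  classical
  rcases T.eq_empty_or_nonempty with rfl | hne
  · simpa using add_nonneg hG hM
  obtain ⟨m, hm, hmax⟩ := T.exists_max_image c hne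
  rw [← Finset.sum_erase_add T d hm]
  rw [← Finset.sum_erase_add T c hm] at hT
  refine add_le_add ?_ (hdM m hm)
  rcases (T.erase m).eq_empty_or_nonempty with hempty | hrest
  · simpa [hempty] using hG
  have hcost : 0 < ∑ i ∈ T.erase m, c i :=
    Finset.sum_pos (fun i hi => hc i (Finset.mem_of_mem_erase hi)) hrest
  refine le_of_mul_le_mul_right ?_ hcost
  rw [Finset.sum_mul, mul_comm G, Finset.sum_mul]
  refine Finset.sum_le_sum fun i hi => ?_
  have hiT := Finset.mem_of_mem_erase hi
  refine le_trans (mul_le_mul_of_nonneg_left ?_ (hd i hiT)) (hdG i hiT)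
  linarith [hmax i hiT]

theorem sum_residual_le (hfin : FiniteExpectation f p) (hf : IsAdaptiveSubmodular f p)
    (hc : ∀ e, 0 < c e) {eStar : E}
    (heStar : ∀ e, singletonValue f p e ≤ singletonValue f p eStar)
    (hφ : p φ ≠ 0) (S : Finset E) {A : Finset E} (hA : ∑ e ∈ A, c e ≤ b) :
    ∑ e ∈ A, residual f p (finalObservation (greedyNext f p c b rank S) φ) e ≤
      ∑ e ∈ Sᶜ, gain f p (greedyNext f p c b rank (insert e S)) φ e +
        (∑ e ∈ S, gain f p (greedyNext f p c b rank S) φ e + singletonValue f p eStar) := by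
  classical
  set ψ := finalObservation (greedyNext f p c b rank S) φ
  let missed (e : E) : Prop :=
    e ∉ S ∧ residual f p ψ e ≤ gain f p (greedyNext f p c b rank (insert e S)) φ e
  rw [← Finset.sum_filter_add_sum_filter_not A missed]
  refine add_le_add ?_ ?_
  · calc ∑ e ∈ A with missed e, residual f p ψ e
        ≤ ∑ e ∈ A with missed e, gain f p (greedyNext f p c b rank (insert e S)) φ e :=
          Finset.sum_le_sum fun e he => (Finset.mem_filter.mp he).2.2
      _ ≤ _ := Finset.sum_le_sum_of_subset_of_nonneg
          (fun e he => Finset.mem_compl.mpr (Finset.mem_filter.mp he).2.1)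
          fun _ _ _ => gain_greedyNext_nonneg
  · refine sum_le_add_of_density_le (fun e _ => hc e)
      (Finset.sum_nonneg fun _ _ => gain_greedyNext_nonneg) (singletonValue_nonneg f p eStar) ?_
      (fun e _ => residual_nonneg ψ e)
      (fun e he => (le_gain_or_mul_le_sum_gain hf hc hφ S e).resolve_left
        (Finset.mem_filter.mp he).2)
      fun e _ => (residual_le_singletonValue hfin hf ψ e).trans (heStar e)
    exact (Finset.sum_le_sum_of_subset_of_nonneg (Finset.filter_subset _ _)
      fun e _ _ => (hc e).le).trans hA

theorem sum_expect_gain_le (hfin : FiniteExpectation f p) (hf : IsAdaptiveSubmodular f p)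
    (S : Finset E) :
    ∑ e ∈ S, expect p (fun φ => gain f p (greedyNext f p c b rank S) φ e) ≤
      expect p fun φ => (f (dom (finalObservation (greedyNext f p c b rank S) φ)) φ : ℝ) := by
  rw [← expect_sum fun e _ => hasExpectation_gain_greedyNext hfin hf S e]
  simp only [sum_gain_greedyNext]
  exact expect_sum_gain_le hfin hf isFresh_greedyNext
    fun _ _ h => (marginal_pos_of_greedyNext h).le

theorem expect_out_union_greedyNext_le (hfin : FiniteExpectation f p)
    (hf : IsAdaptiveSubmodular f p) (hc : ∀ e, 0 < c e) {eStar : E}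
    (heStar : ∀ e, singletonValue f p e ≤ singletonValue f p eStar) {π : Policy E O}
    (hπ : Feasible p c b π) (S : Finset E) :
    expect p (fun φ => expect (π.out φ) fun A =>
        (f (A ∪ dom (finalObservation (greedyNext f p c b rank S) φ)) φ : ℝ)) ≤
      expect p (fun φ => (f (dom (finalObservation (greedyNext f p c b rank S) φ)) φ : ℝ)) +
        (∑ e ∈ Sᶜ, expect p (fun φ => gain f p (greedyNext f p c b rank (insert e S)) φ e) +
          (∑ e ∈ S, expect p (fun φ => gain f p (greedyNext f p c b rank S) φ e) +
            singletonValue f p eStar)) := by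
  have hgain (T : E → Finset E) (e : E) :
      HasExpectation p fun φ => gain f p (greedyNext f p c b rank (T e)) φ e :=
    hasExpectation_gain_greedyNext hfin hf (T e) e
  have hmissed := HasExpectation.sum fun e (_ : e ∈ Sᶜ) => hgain (fun e => insert e S) e
  have hcollected := HasExpectation.sum fun e (_ : e ∈ S) => hgain (fun _ => S) e
  refine (expect_out_union_finalObservation_le hfin hf isFresh_greedyNext π).trans ?_
  rw [← expect_sum fun e _ => hgain (fun e => insert e S) e,
    ← expect_sum fun e _ => hgain (fun _ => S) e,
    ← expect_const p (singletonValue f p eStar), ← expect_add hcollected (.const _ _),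
    ← expect_add hmissed (hcollected.add (.const _ _))]
  refine add_le_add_right (expect_mono (.expect (hasExpectation_sum_residual hfin hf _) _)
    (hmissed.add (hcollected.add (.const _ _))) fun φ _ hφ => ?_) _
  rw [← expect_const (π.out φ) (_ + _)]
  exact expect_mono (.of_finite _ _) (.const _ _) fun A _ hA =>
    sum_residual_le hfin hf hc heStar hφ S (hπ φ hφ A hA)

end Greedy

/-! ### Sampling -/

section Sampling

variable {E : Type*} [Fintype E] [DecidableEq E] {σ : ℝ}

theorem toReal_sampleLaw (h0 : 0 < σ) (h1 : σ ≤ 1) (S : Finset E) :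
    (sampleLaw E σ h0 h1 S).toReal = σ ^ S.card * (1 - σ) ^ (Fintype.card E - S.card) := by
  simp [sampleLaw, PMF.ofFintype_apply, ENNReal.toReal_mul, ENNReal.toReal_pow,
    ENNReal.toReal_ofReal h0.le, ENNReal.toReal_ofReal (sub_nonneg.mpr h1)]

theorem toReal_sampleLaw_of_notMem (h0 : 0 < σ) (h1 : σ ≤ 1) {S : Finset E} {e : E}
    (he : e ∉ S) :
    (sampleLaw E σ h0 h1 S).toReal =
      (1 / σ - 1) * (sampleLaw E σ h0 h1 (insert e S)).toReal := by
  obtain ⟨k, hk⟩ := Nat.exists_eq_add_of_lt (Finset.card_lt_univ_of_notMem he)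
  rw [toReal_sampleLaw, toReal_sampleLaw, Finset.card_insert_of_notMem he,
    show Fintype.card E - S.card = k + 1 by omega,
    show Fintype.card E - (S.card + 1) = k by omega]
  field_simp
  ring

theorem expect_sampleLaw_compl (h0 : 0 < σ) (h1 : σ ≤ 1) (G : E → Finset E → ℝ) :
    expect (sampleLaw E σ h0 h1) (fun S => ∑ e ∈ Sᶜ, G e (insert e S)) =
      (1 / σ - 1) * expect (sampleLaw E σ h0 h1) fun S => ∑ e ∈ S, G e S := by
  simp only [expect_eq_sum, Finset.mul_sum, Finset.sum_sigma']
  refine Finset.sum_nbij' (fun x => ⟨insert x.2 x.1, x.2⟩) (fun x => ⟨x.1.erase x.2, x.2⟩)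
    (by simp) (by simp) (fun x hx => ?_) (fun x hx => ?_) fun x hx => ?_
  · rw [Finset.erase_insert (by simpa using hx)]
  · rw [Finset.insert_erase (by simpa using hx)]
  · rw [toReal_sampleLaw_of_notMem h0 h1 (e := x.2) (by simpa using hx), mul_assoc]

end Sampling

/-! ### The sampled greedy policy -/

section SampledGreedy

variable {E O : Type*} [Fintype E]

theorem expectedUtility_eq_expect (f : Finset E → (E → O) → ℝ≥0) (p : PMF (E → O))
    (K : (E → O) → PMF (Finset E)) :
    expectedUtility f p K = expect p fun φ => expect (K φ) fun A => (f A φ : ℝ) := by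
  simp only [expect_eq_sum (K _)]
  rw [expect, Set.indicator_univ, expectedUtility]

variable [DecidableEq E] {f : Finset E → (E → O) → ℝ≥0} {p : PMF (E → O)} {c : E → ℝ} {b : ℝ}
  {rank : PartialRealization E O → E ↪ ℕ} {σ : ℝ} {h0 : 0 < σ} {h1 : σ ≤ 1}

theorem favg_nonneg (f : Finset E → (E → O) → ℝ≥0) (p : PMF (E → O)) (π : Policy E O) :
    0 ≤ favg f p π := by
  rw [favg, expectedUtility_eq_expect]
  exact expect_nonneg fun φ _ => expect_nonneg fun A _ => (f A φ).coe_nonneg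

theorem expect_sampledGreedy_out (φ : E → O) (H : Finset E → ℝ) :
    expect ((sampledGreedy f p c b rank σ h0 h1).out φ) H =
      expect (sampleLaw E σ h0 h1) fun S =>
        H (dom (finalObservation (greedyNext f p c b rank S) φ)) := by
  rw [Policy.out, expect_bind]
  refine expect_congr fun S _ _ => ?_
  simp only [sampledGreedy, runFrom_pure, PMF.pure_map, expect_pure, finalObservation]

theorem favg_sampledGreedy (hfin : FiniteExpectation f p) :
    favg f p (sampledGreedy f p c b rank σ h0 h1) =
      expect (sampleLaw E σ h0 h1) fun S => expect p fun φ =>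
        (f (dom (finalObservation (greedyNext f p c b rank S) φ)) φ : ℝ) := by
  simp only [favg, expectedUtility_eq_expect, expect_sampledGreedy_out]
  exact expect_expect_comm (.sum fun A (_ : A ∈ Finset.univ) => .abs (hfin A)) fun S φ =>
    abs_le_sum_abs (fun A => (f A φ : ℝ)) _

theorem favgConcat_sampledGreedy (hfin : FiniteExpectation f p) (π : Policy E O) :
    favgConcat f p π (sampledGreedy f p c b rank σ h0 h1) =
      expect (sampleLaw E σ h0 h1) fun S => expect p fun φ => expect (π.out φ) fun A =>
        (f (A ∪ dom (finalObservation (greedyNext f p c b rank S) φ)) φ : ℝ) := by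
  simp only [favgConcat, expectedUtility_eq_expect, concatOut, expect_bind, expect_map,
    expect_sampledGreedy_out]
  have hcomm (φ : E → O) := expect_expect_comm (C := Set.univ) (μ := sampleLaw E σ h0 h1)
    (X := fun S A => (f (A ∪ dom (finalObservation (greedyNext f p c b rank S) φ)) φ : ℝ))
    (.const (π.out φ) _) fun S A => abs_le_sum_abs (fun A => (f A φ : ℝ)) _
  simp only [hcomm]
  exact expect_expect_comm (.sum fun A (_ : A ∈ Finset.univ) => .abs (hfin A)) fun S φ =>
    abs_expect_le_of_forall_abs_le fun A => abs_le_sum_abs (fun A => (f A φ : ℝ)) _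

end SampledGreedy

end

end AdaptiveSubmodular

open AdaptiveSubmodular in
theorem mainTheorem4_general {E : Type u} {O : Type v} [Fintype E] [DecidableEq E]
    (p : PMF (E → O)) (f : Finset E → (E → O) → ℝ≥0) (hfin : FiniteExpectation f p)
    (hf : IsAdaptiveSubmodular f p)
    (c : E → ℝ) (hc : ∀ e, 0 < c e) (b : ℝ)
    (σ : ℝ) (hσ0 : 0 < σ) (hσ1 : σ ≤ 1)
    (rank : PartialRealization E O → E ↪ ℕ)
    (eStar : E) (heStar : ∀ e, singletonValue f p e ≤ singletonValue f p eStar)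
    (π : Policy E O) (hπ : Feasible p c b π) :
    favgConcat f p π (sampledGreedy f p c b rank σ hσ0 hσ1) ≤
      (1 + 1 / σ) * favg f p (sampledGreedy f p c b rank σ hσ0 hσ1) +
        singletonValue f p eStar := by
  set q := sampleLaw E σ hσ0 hσ1
  let utility (S : Finset E) : ℝ := expect p fun φ =>
    (f (dom (finalObservation (greedyNext f p c b rank S) φ)) φ : ℝ)
  let itemValue (e : E) (S : Finset E) : ℝ := expect p fun φ =>
    gain f p (greedyNext f p c b rank S) φ e
  have hle : expect q (fun S => ∑ e ∈ S, itemValue e S) ≤ expect q utility :=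
    expect_mono (.of_finite _ _) (.of_finite _ _) fun S _ _ => sum_expect_gain_le hfin hf S
  rw [favg_sampledGreedy hfin, favgConcat_sampledGreedy hfin]
  calc _ ≤ expect q fun S => utility S + (∑ e ∈ Sᶜ, itemValue e (insert e S) +
          (∑ e ∈ S, itemValue e S + singletonValue f p eStar)) :=
        expect_mono (.of_finite _ _) (.of_finite _ _) fun S _ _ =>
          expect_out_union_greedyNext_le hfin hf hc heStar hπ S
    _ = expect q utility + ((1 / σ - 1) * expect q (fun S => ∑ e ∈ S, itemValue e S) +
          (expect q (fun S => ∑ e ∈ S, itemValue e S) + singletonValue f p eStar)) := by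
        simp only [expect_add (HasExpectation.of_finite q _) (HasExpectation.of_finite q _),
          expect_sampleLaw_compl, expect_const, q]
    _ ≤ (1 + 1 / σ) * expect q utility + singletonValue f p eStar := by
        linarith [mul_le_mul_of_nonneg_left hle (one_div_pos.mpr hσ0).le]

open AdaptiveSubmodular in
theorem mainTheorem4 {E : Type u} {O : Type v} [Fintype E] [DecidableEq E]
    (p : PMF (E → O)) (f : Finset E → (E → O) → ℝ≥0) (hfin : FiniteExpectation f p)
    (hf : IsAdaptiveSubmodular f p)
    (c : E → ℝ) (hc : ∀ e, 0 < c e) (b : ℝ)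
    (σ : ℝ) (hσ0 : 0 < σ) (hσ1 : σ ≤ 1)
    (rank : PartialRealization E O → E ↪ ℕ)
    (eStar : E) (heStar : ∀ e, singletonValue f p e ≤ singletonValue f p eStar)
    (πopt : Policy E O) (hopt : IsOptimal f p c b πopt) :
    favgConcat f p πopt (sampledGreedy f p c b rank σ hσ0 hσ1) ≤
      (2 + 1 / σ) * favg f p (sampledGreedy f p c b rank σ hσ0 hσ1) +
        singletonValue f p eStar := by
  refine (mainTheorem4_general p f hfin hf c hc b σ hσ0 hσ1 rank eStar heStar πopt hopt.1).trans ?_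
  linarith [favg_nonneg f p (sampledGreedy f p c b rank σ hσ0 hσ1)]
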